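/- Let $1\le m\le n$ be integers, let $|\psi\rangle=\sum_{x\in\{0,1\}^n}\Psi(x)|x\rangle$ be a normalized $n$-qubit pure state and let $\rho$ be an $n$-qubit density operator. For a set $k\subseteq[n]$ of $m$ qubits, $z\in\{0,1\}^{[n]\setminus k}$ and $\ell\in\{0,1\}^{k}$, let $z^{\ell}\in\{0,1\}^n$ be the string that equals $\ell$ on $k$ and $z$ elsewhere, and put $$|\Psi_{z}\rangle=\frac{\sum_{\ell}\Psi(z^\ell)|\ell\rangle}{\sqrt{\sum_{\ell}|\Psi(z^\ell)|^2}},\qquad L_{z}=|\Psi_{z}\rangle\langle\Psi_{z}|,\qquad L=\binom nm^{-1}\sum_{|k|=m}\ \sum_{z\in\{0,1\}^{[n]\setminus k}}|z\rangle\langle z|\otimes L_{z},$$ with $|\Psi_z\rangle=0$ if the denominator vanishes. The random variable $\omega$ is produced from one copy of $\rho$ by one run of the level-$m$ shadow overlap protocol with random Cliffords: choose a uniformly random $m$-element set $k\subseteq[n]$; measure all qubits outside $k$ in the computational basis, with outcome $z$; apply a uniformly random element $U$ of the $m$-qubit Clifford group (unitaries normalizing the Pauli group, modulo global phases) to the qubits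 in $k$ and measure them in the computational basis, with outcome $b$; form $\sigma=(2^m+1)\,U^\dagger|b\rangle\langle b|U-\mathbb I$ and return $\omega=\mathrm{tr}(L_z\sigma)$. Let $S=\sum_x|\Psi(x)|^2|x\rangle\langle x|$, $F=\sum_x e^{i\arg\Psi(x)}|x\rangle\langle x|$ and $P=S^{-1/2}F^\dagger LFS^{1/2}$ (if $\Psi$ has zeros, $S^{-1/2}$ is the inverse on the support of $\Psi$ and zero elsewhere). Let $\lambda_1$ be the second largest eigenvalue of $P$, counted with multiplicity. Theorem. 1. If $\lambda_1=1-\frac1\tau$ with $0<\tau<\infty$, then for every real $\varepsilon$: $\mathbb E[\omega]\ge 1-\varepsilon$ implies $\langle\psi|\rho|\psi\rangle\ge 1-\tau\varepsilon$. 2. For every real $\varepsilon$: $\langle\psi|\rho|\psi\rangle\ge 1-\varepsilon$ implies $\mathbb E[\omega]\ge 1-\varepsilon$. -/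

import Mathlib

noncomputable section

namespace ShadowOverlap

open Matrix
open scoped Kronecker ComplexOrder

/-- Bit strings on a register whose qubits are labelled by `ι`. -/
abbrev Bits (ι : Type) : Type := ι → Bool

/-- Operators on the register `ι`, as matrices in the computational basis. -/
abbrev Op (ι : Type) : Type := Matrix (Bits ι) (Bits ι) ℂ

/-- Unitary operators on the register `ι`. -/
abbrev UnitaryOp (ι : Type) [Fintype ι] [DecidableEq ι] : Type :=
  ↥(Matrix.unitaryGroup (Bits ι) ℂ)

/-- The labels of the single-qubit Pauli operators. -/
inductive Pauli : Type
  | I | X | Y | Z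
  deriving DecidableEq

instance instFintypePauli : Fintype Pauli :=
  ⟨{.I, .X, .Y, .Z}, fun p => by cases p <;> simp⟩

section Register

variable {ι : Type} [Fintype ι] [DecidableEq ι]

/-- The rank-one operator `|v⟩⟨v|`. -/
def outer (v : Bits ι → ℂ) : Op ι := Matrix.vecMulVec v (star v)

/-- The computational basis vector `|b⟩`. -/
def ket (b : Bits ι) : Bits ι → ℂ := Pi.single b 1

/-! ### The Clifford group -/

/-- The single-qubit Pauli matrices, with rows and columns indexed by `false = 0`, `true = 1`. -/
def Pauli.mat : Pauli → Matrix Bool Bool ℂ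
  | .I => 1
  | .X => Matrix.of fun x y => if x = y then 0 else 1
  | .Y => Matrix.of fun x y => if x = y then 0 else if x then Complex.I else -Complex.I
  | .Z => Matrix.of fun x y => if x = y then (if x then -1 else 1) else 0

/-- The tensor product of the single-qubit Pauli operators `w i`, `i ∈ ι`. -/
def pauliString (w : ι → Pauli) : Op ι :=
  Matrix.of fun x y => ∏ i, (w i).mat (x i) (y i)

/-- The Pauli group: all operators `i ^ k P` with `k ∈ {0, 1, 2, 3}` and `P` a Pauli string. -/
def pauliGroup (ι : Type) [Fintype ι] [DecidableEq ι] : Set (UnitaryOp ι) :=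
  {U | ∃ (k : Fin 4) (w : ι → Pauli), (U : Op ι) = Complex.I ^ (k : ℕ) • pauliString w}

/-- The Clifford unitaries: the normalizer of the Pauli group in the unitary group. -/
def cliffordUnitaries (ι : Type) [Fintype ι] [DecidableEq ι] : Subgroup (UnitaryOp ι) :=
  Subgroup.normalizer (pauliGroup ι)

/-- The global phases: the unitaries that are scalar multiples of the identity. -/
def globalPhases (ι : Type) [Fintype ι] [DecidableEq ι] : Subgroup (UnitaryOp ι) where
  carrier := {U | ∃ c : ℂ, (U : Op ι) = c • (1 : Op ι)}
  one_mem' := ⟨1, by simp⟩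
  mul_mem' := by
    rintro U V ⟨c, hc⟩ ⟨d, hd⟩
    exact ⟨c * d, by simp [hc, hd, smul_smul, mul_comm]⟩
  inv_mem' := by
    rintro U ⟨c, hc⟩
    exact ⟨star c, by simp [Matrix.UnitaryGroup.inv_val, hc, star_smul]⟩

/-- The Clifford group (unitaries that differ by a global phase are identified). -/
abbrev Clifford (ι : Type) [Fintype ι] [DecidableEq ι] : Type :=
  cliffordUnitaries ι ⧸ (globalPhases ι).subgroupOf (cliffordUnitaries ι)

/-- A unitary representing an element of the Clifford group. Everything below depends on the
unitary only through conjugation, so the choice of the phase is immaterial. -/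
def Clifford.unitary (c : Clifford ι) : UnitaryOp ι := (Quotient.out c : cliffordUnitaries ι).1

lemma Pauli.mat_mul_star (p : Pauli) : p.mat * star p.mat = 1 := by
  ext x y
  cases p <;> cases x <;> cases y <;>
    simp [Pauli.mat, Matrix.mul_apply, Matrix.star_apply, Matrix.one_apply]

lemma pauliString_mem_unitaryGroup (w : ι → Pauli) :
    pauliString w ∈ Matrix.unitaryGroup (Bits ι) ℂ := by
  rw [Matrix.mem_unitaryGroup_iff]
  ext x y
  have h : ∀ i, ∑ b : Bool, (w i).mat (x i) b * star ((w i).mat (y i) b)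
      = (1 : Matrix Bool Bool ℂ) (x i) (y i) := fun i => by
    rw [← Pauli.mat_mul_star (w i)]
    simp [Matrix.mul_apply, Matrix.star_apply]
  calc (pauliString w * star (pauliString w)) x y
      = ∑ z : Bits ι, ∏ i, ((w i).mat (x i) (z i) * star ((w i).mat (y i) (z i))) := by
        simp [Matrix.mul_apply, Matrix.star_apply, pauliString, Finset.prod_mul_distrib]
    _ = ∏ i, ∑ b : Bool, (w i).mat (x i) b * star ((w i).mat (y i) b) := by
        rw [Finset.prod_univ_sum, Fintype.piFinset_univ]
    _ = (1 : Op ι) x y := by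
        simp only [h, Matrix.one_apply]
        by_cases hxy : x = y
        · subst hxy; simp
        · obtain ⟨i, hi⟩ := Function.ne_iff.mp hxy
          rw [if_neg hxy]
          exact Finset.prod_eq_zero (Finset.mem_univ i) (if_neg hi)

/-- An operator that commutes with all Pauli strings is a multiple of the identity. -/
lemma eq_smul_one_of_commute_pauli (M : Op ι)
    (h : ∀ w : ι → Pauli, M * pauliString w = pauliString w * M) :
    ∃ c : ℂ, M = c • (1 : Op ι) := by
  have hoff : ∀ x y, x ≠ y → M x y = 0 := by
    intro x y hxy
    obtain ⟨i, hi⟩ := Function.ne_iff.mp hxy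
    let w : ι → Pauli := fun j => if j = i then .Z else .I
    have hw : pauliString w = Matrix.diagonal fun z : Bits ι => if z i then (-1 : ℂ) else 1 := by
      ext a b
      by_cases hab : a = b
      · subst hab
        rw [Matrix.diagonal_apply_eq]
        simp only [pauliString, Matrix.of_apply]
        rw [Finset.prod_eq_single i]
        · simp [w, Pauli.mat]
        · intro j _ hj
          simp [w, hj, Pauli.mat]
        · simp
      · rw [Matrix.diagonal_apply_ne _ hab]
        obtain ⟨j, hj⟩ := Function.ne_iff.mp hab
        refine Finset.prod_eq_zero (Finset.mem_univ j) ?_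
        by_cases hji : j = i
        · subst hji
          simp [w, Pauli.mat, hj]
        · simp [w, hji, Pauli.mat, hj]
    have h1 := congrFun (congrFun (h w) x) y
    rw [hw, Matrix.mul_diagonal, Matrix.diagonal_mul] at h1
    cases hx : x i <;> cases hy : y i <;> simp [hx, hy] at hi h1
    · exact self_eq_neg.mp h1.symm
    · exact self_eq_neg.mp h1
  have hdiag : ∀ x y, M x x = M y y := by
    intro x y
    let w : ι → Pauli := fun j => if x j = y j then .I else .X
    have hw : ∀ a b : Bits ι, pauliString w a b
        = if (∀ j, (a j = b j ↔ x j = y j)) then 1 else 0 := by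
      intro a b
      simp only [pauliString, Matrix.of_apply]
      split_ifs with hab
      · refine Finset.prod_eq_one fun j _ => ?_
        by_cases hj : x j = y j
        · simp [w, hj, Pauli.mat, Matrix.one_apply, (hab j).2 hj]
        · have : a j ≠ b j := fun h' => hj ((hab j).1 h')
          simp [w, hj, Pauli.mat, this]
      · push Not at hab
        obtain ⟨j, hj⟩ := hab
        refine Finset.prod_eq_zero (Finset.mem_univ j) ?_
        by_cases hxj : x j = y j
        · have : a j ≠ b j := by tauto
          simp [w, hxj, Pauli.mat, this]
        · have : a j = b j := by tauto
          simp [w, hxj, Pauli.mat, this]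
    have h1 := congrFun (congrFun (h w) x) y
    rw [Matrix.mul_apply, Matrix.mul_apply, Finset.sum_eq_single x, Finset.sum_eq_single y] at h1
    · simpa [hw] using h1
    · intro z _ hz
      rw [hoff z y hz, mul_zero]
    · simp
    · intro z _ hz
      rw [hoff x z (Ne.symm hz), zero_mul]
    · simp
  refine ⟨M (fun _ => false) (fun _ => false), ?_⟩
  ext x y
  by_cases hxy : x = y
  · subst hxy; simpa using hdiag _ _
  · simp [hoff x y hxy, hxy]

instance instFiniteClifford : Finite (Clifford ι) := by
  let P : (ι → Pauli) → UnitaryOp ι := fun w => ⟨pauliString w, pauliString_mem_unitaryGroup w⟩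
  have hP : ∀ w, P w ∈ pauliGroup ι := fun w => ⟨0, w, by simp [P]⟩
  have hfin : (pauliGroup ι).Finite := by
    refine Set.Finite.of_finite_image (f := fun U : UnitaryOp ι => (U : Op ι)) ?_
      (fun _ _ _ _ h => Subtype.ext h)
    refine (Set.finite_range fun q : Fin 4 × (ι → Pauli) =>
      Complex.I ^ (q.1 : ℕ) • pauliString q.2).subset ?_
    rintro _ ⟨U, ⟨k, w, h⟩, rfl⟩
    exact ⟨(k, w), h.symm⟩
  have : Finite (pauliGroup ι) := hfin
  let f : Clifford ι → (ι → Pauli) → pauliGroup ι := fun c w =>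
    ⟨(Quotient.out c).1 * P w * (Quotient.out c).1⁻¹,
      (Subgroup.mem_set_normalizer_iff.mp (Quotient.out c).2 _).mp (hP w)⟩
  refine Finite.of_injective f fun c d hcd => ?_
  have key : ∀ w, ((Quotient.out c).1⁻¹ * (Quotient.out d).1) * P w
      = P w * ((Quotient.out c).1⁻¹ * (Quotient.out d).1) := by
    intro w
    have h1 : (Quotient.out c).1 * P w * (Quotient.out c).1⁻¹
        = (Quotient.out d).1 * P w * (Quotient.out d).1⁻¹ :=
      congrArg Subtype.val (congrFun hcd w)
    have h2 := congrArg (fun V => (Quotient.out c).1⁻¹ * V * (Quotient.out d).1) h1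
    simpa [mul_assoc] using h2.symm
  rw [← Quotient.out_eq c, ← Quotient.out_eq d]
  refine QuotientGroup.eq.mpr ?_
  rw [Subgroup.mem_subgroupOf]
  exact eq_smul_one_of_commute_pauli _ fun w => congrArg Subtype.val (key w)

instance instFintypeClifford : Fintype (Clifford ι) := Fintype.ofFinite _

/-! ### States and measurements -/

/-- Density operators on the register `ι`. -/
structure DensityOp (ι : Type) [Fintype ι] [DecidableEq ι] where
  mat : Op ι
  posSemidef : mat.PosSemidef
  trace_eq_one : mat.trace = 1

/-- The basis state `|b⟩⟨b|`. -/
def DensityOp.basis (b : Bits ι) : DensityOp ι where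
  mat := outer (ket b)
  posSemidef := Matrix.posSemidef_vecMulVec_self_star _
  trace_eq_one := by simp [outer, ket, Matrix.trace_vecMulVec]

/-- The state `U ρ U†`. -/
def DensityOp.conj (ρ : DensityOp ι) (U : UnitaryOp ι) : DensityOp ι where
  mat := U.1 * ρ.mat * star U.1
  posSemidef := ρ.posSemidef.mul_mul_conjTranspose_same U.1
  trace_eq_one := by
    rw [Matrix.trace_mul_comm, ← mul_assoc, Matrix.UnitaryGroup.star_mul_self, one_mul,
      ρ.trace_eq_one]

/-- The outcome of measuring all qubits of `ρ` in the computational basis: `b` has probability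
`⟨b|ρ|b⟩`. -/
def DensityOp.measure (ρ : DensityOp ι) : PMF (Bits ι) :=
  PMF.ofFintype (fun b => ENNReal.ofReal (ρ.mat b b).re) (by
    rw [← ENNReal.ofReal_sum_of_nonneg fun b _ => (Complex.le_def.mp ρ.posSemidef.diag_nonneg).1,
      ← Complex.re_sum]
    have h := ρ.trace_eq_one
    simp only [Matrix.trace, Matrix.diag_apply] at h
    simp [h])

/-- The fidelity `⟨ψ|ρ|ψ⟩` of `ρ` with the pure state with amplitudes `Ψ`. -/
def fidelity (Ψ : Bits ι → ℂ) (ρ : DensityOp ι) : ℝ := (star Ψ ⬝ᵥ (ρ.mat *ᵥ Ψ)).re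

/-- The classical shadow `(2 ^ m + 1) U† |b⟩⟨b| U - 1` of a register of `m` qubits. -/
def cliffordShadow (U : UnitaryOp ι) (b : Bits ι) : Op ι :=
  ((2 : ℂ) ^ Fintype.card ι + 1) • (star U.1 * outer (ket b) * U.1) - 1

/-- The second largest eigenvalue, with algebraic multiplicity, of a matrix whose eigenvalues are
all real (as those of `transitionMatrix` below are): entry number `1`, counting from `0`, of the
list of the roots of the characteristic polynomial in decreasing order. -/
def secondLargestEigenvalue (A : Op ι) : ℝ :=
  ((A.charpoly.roots.map Complex.re).sort (· ≥ ·)).getD 1 0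

end Register

/-! ### The operator `L`, the Markov chain and the protocol

In what follows `k` is a set of qubits, and `z` is a string of bits on the other qubits. -/

section Protocol

variable {n : ℕ}

/-- Splits a bit string into its bits on `k` and its bits off `k`. -/
def splitBits (k : Finset (Fin n)) :
    Bits (Fin n) ≃ Bits {i // i ∈ k} × Bits {i // i ∉ k} :=
  Equiv.piEquivPiSubtypeProd (fun i => i ∈ k) fun _ => Bool

/-- The bit string that equals `l` on `k` and `z` on the remaining qubits. -/
def glue (k : Finset (Fin n)) (z : Bits {i // i ∉ k}) (l : Bits {i // i ∈ k}) : Bits (Fin n) :=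
  (splitBits k).symm (l, z)

/-- The normalized state `|Ψ_z⟩` on the qubits in `k` to which the state with amplitudes `Ψ`
collapses when the other qubits are measured with outcome `z`. It is the zero vector when that
outcome has probability zero. -/
def collapsed (Ψ : Bits (Fin n) → ℂ) (k : Finset (Fin n)) (z : Bits {i // i ∉ k}) :
    Bits {i // i ∈ k} → ℂ :=
  fun l => Ψ (glue k z l) / (Real.sqrt (∑ l', ‖Ψ (glue k z l')‖ ^ 2) : ℂ)

/-- The local observable `L_z = |Ψ_z⟩⟨Ψ_z|`. -/
def localL (Ψ : Bits (Fin n) → ℂ) (k : Finset (Fin n)) (z : Bits {i // i ∉ k}) :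
    Op {i // i ∈ k} :=
  outer (collapsed Ψ k z)

/-- The operator
`L = (n choose m)⁻¹ ∑_{k ⊆ [n], |k| = m} ∑_{z ∈ {0,1}^(n-m)} |z⟩⟨z| ⊗ L_z`. -/
def overlapOperator (m : ℕ) (Ψ : Bits (Fin n) → ℂ) : Op (Fin n) :=
  ((n.choose m : ℂ))⁻¹ • ∑ k ∈ Finset.powersetCard m Finset.univ, ∑ z : Bits {i // i ∉ k},
    (localL Ψ k z ⊗ₖ outer (ket z)).submatrix (splitBits k) (splitBits k)

/-- The transition matrix `P = S^(-1/2) F† L F S^(1/2)`, where `S = ∑ₓ |Ψ(x)|² |x⟩⟨x|` holds the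
probabilities of the target state and `F = ∑ₓ exp(i arg Ψ(x)) |x⟩⟨x|` its phases. When `Ψ` has
zeros, `S^(-1/2)` is the inverse on the support of `Ψ`, so that `P` is the transition matrix of the
chain on the support, extended by zero. -/
def transitionMatrix (m : ℕ) (Ψ : Bits (Fin n) → ℂ) : Op (Fin n) :=
  let sqrtS : Op (Fin n) := Matrix.diagonal fun x => (‖Ψ x‖ : ℂ)
  let invSqrtS : Op (Fin n) := Matrix.diagonal fun x => (‖Ψ x‖ : ℂ)⁻¹
  let F : Op (Fin n) := Matrix.diagonal fun x => Complex.exp (Complex.I * (Complex.arg (Ψ x) : ℂ))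
  invSqrtS * Fᴴ * overlapOperator m Ψ * F * sqrtS

/-- The unnormalized state `⟨z|ρ|z⟩` of the qubits in `k`. -/
def block (ρ : DensityOp (Fin n)) (k : Finset (Fin n)) (z : Bits {i // i ∉ k}) :
    Op {i // i ∈ k} :=
  ρ.mat.submatrix (glue k z) (glue k z)

lemma block_posSemidef (ρ : DensityOp (Fin n)) (k : Finset (Fin n)) (z : Bits {i // i ∉ k}) :
    (block ρ k z).PosSemidef :=
  ρ.posSemidef.submatrix _

lemma sum_trace_block (ρ : DensityOp (Fin n)) (k : Finset (Fin n)) :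
    ∑ z, (block ρ k z).trace = 1 := by
  rw [← ρ.trace_eq_one, Matrix.trace, ← (splitBits k).symm.sum_comp, Fintype.sum_prod_type_right]
  rfl

/-- The outcome of measuring all qubits outside `k` in the computational basis: `z` has
probability `tr ⟨z|ρ|z⟩`. -/
def measureOutside (ρ : DensityOp (Fin n)) (k : Finset (Fin n)) : PMF (Bits {i // i ∉ k}) :=
  PMF.ofFintype (fun z => ENNReal.ofReal (block ρ k z).trace.re) (by
    rw [← ENNReal.ofReal_sum_of_nonneg fun z _ =>
        (Complex.le_def.mp (block_posSemidef ρ k z).trace_nonneg).1,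
      ← Complex.re_sum, sum_trace_block]
    simp)

open Classical in
/-- The state `⟨z|ρ|z⟩ / tr ⟨z|ρ|z⟩` of the qubits in `k` after the outcome `z` was obtained on
the others. (For an outcome of probability zero an arbitrary state is taken.) -/
def postMeasurement (ρ : DensityOp (Fin n)) (k : Finset (Fin n)) (z : Bits {i // i ∉ k}) :
    DensityOp {i // i ∈ k} :=
  if h : (block ρ k z).trace = 0 then DensityOp.basis fun _ => false
  else
    { mat := (block ρ k z).trace⁻¹ • block ρ k z
      posSemidef := (block_posSemidef ρ k z).smul
        (inv_nonneg_of_nonneg (block_posSemidef ρ k z).trace_nonneg)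
      trace_eq_one := by rw [Matrix.trace_smul, smul_eq_mul, inv_mul_cancel₀ h] }

/-- The law of the shadow overlap `ω` that one run of the level-`m` protocol with random Cliffords
computes from one copy of `ρ`:
* choose a uniformly random set `k` of `m` qubits;
* measure the other qubits in the computational basis, with outcome `z`;
* apply a uniformly random Clifford `U` to the qubits in `k`;
* measure them in the computational basis, with outcome `b`;
* return `ω = tr (L_z σ)`, where `σ` is the classical shadow. -/
def shadowOverlapLaw (m : ℕ) (hm : m ≤ n) (Ψ : Bits (Fin n) → ℂ) (ρ : DensityOp (Fin n)) :
    PMF ℝ :=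
  (PMF.uniformOfFinset (Finset.powersetCard m (Finset.univ : Finset (Fin n)))
      (Finset.powersetCard_nonempty.mpr (by simpa using hm))).bind fun k =>
    (measureOutside ρ k).bind fun z =>
      (PMF.uniformOfFintype (Clifford {i // i ∈ k})).bind fun c =>
        ((postMeasurement ρ k z).conj c.unitary).measure.bind fun b =>
          PMF.pure (localL Ψ k z * cliffordShadow c.unitary b).trace.re

/-- The (expected) shadow overlap `𝔼[ω]`; note that `ω` takes only finitely many values. -/
def shadowOverlap (m : ℕ) (hm : m ≤ n) (Ψ : Bits (Fin n) → ℂ) (ρ : DensityOp (Fin n)) : ℝ :=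
  ∫ x, x ∂(shadowOverlapLaw m hm Ψ ρ).toMeasure

end Protocol

end ShadowOverlap

end

/-! The mean of `ω` is `tr (L ρ)`, and both claims follow from the operator inequalities `|ψ⟩⟨ψ| ≤ L
≤ λ₁ (1 - |ψ⟩⟨ψ|) + |ψ⟩⟨ψ|`. Writing `f` for the fidelity and `λ₁ = 1 - 1 / τ`, they read `f ≤ 𝔼[ω]
≤ 1 - (1 - f) / τ`.

The trace formula `shadowOverlap_eq_trace` says that the Clifford shadow is unbiased. A
computational basis measurement expands in the Pauli strings with factors `I` and `Z`. The Clifford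
group is transitive on non-identity strings (`exists_clifford_conj`), so all of these have the same
twirl, and Pauli completeness (`sum_trace_pauliString_smul`) determines it. The averaged measurement
is therefore `A ↦ (A + tr A) / (2 ^ m + 1)` (`sum_clifford_measure`), which the shadow inverts.

For the inequalities, each `L_z` fixes the restriction of `Ψ` to the block `z`, so `L` is positive
semidefinite and `L Ψ = Ψ`. Compression to the complement of `Ψ` gives the lower bound
(`posSemidef_sub_vecMulVec`). For the upper bound (`posSemidef_sub_of_gap`), `λ₁ < 1` forces the
eigenvalue `1` to be simple and all others to be at most `λ₁`. The eigenvalues of `P` may be used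
because `P` and `L` have the same characteristic polynomial (`charpoly_transitionMatrix`). -/

noncomputable section

namespace ShadowOverlap

open Matrix
open scoped Kronecker ComplexOrder

/-! ### Multiplication and commutation of Pauli strings -/

section PauliAlgebra

variable {ι : Type} [Fintype ι] [DecidableEq ι]

lemma pauliString_mul_apply (w v : ι → Pauli) (x y : Bits ι) :
    (pauliString w * pauliString v) x y = ∏ i, ((w i).mat * (v i).mat) (x i) (y i) := by
  simp only [pauliString, Matrix.mul_apply, Matrix.of_apply, ← Finset.prod_mul_distrib]
  rw [Finset.prod_univ_sum, Fintype.piFinset_univ]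

omit [DecidableEq ι] in
lemma pauliString_one : pauliString (fun _ : ι => Pauli.I) = 1 := by
  ext x y
  simp only [pauliString, Matrix.of_apply, Pauli.mat, Matrix.one_apply]
  rw [Finset.prod_ite_zero]
  simp [funext_iff]

/-- The product of two Pauli labels, up to a phase. -/
def Pauli.mul : Pauli → Pauli → Pauli
  | .I, q => q
  | p, .I => p
  | .X, .X => .I | .X, .Y => .Z | .X, .Z => .Y
  | .Y, .X => .Z | .Y, .Y => .I | .Y, .Z => .X
  | .Z, .X => .Y | .Z, .Y => .X | .Z, .Z => .I

/-- The exponent of `i` in the phase of the product of two Pauli matrices. -/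
def Pauli.phase : Pauli → Pauli → ℕ
  | .X, .Y => 1 | .Y, .Z => 1 | .Z, .X => 1
  | .Y, .X => 3 | .Z, .Y => 3 | .X, .Z => 3
  | _, _ => 0

/-- The sign with which two Pauli matrices commute. -/
def Pauli.sign (p q : Pauli) : ℤ :=
  if p = .I ∨ q = .I ∨ p = q then 1 else -1

lemma Pauli.mat_mul (p q : Pauli) :
    p.mat * q.mat = Complex.I ^ p.phase q • (p.mul q).mat := by
  ext x y
  cases p <;> cases q <;> cases x <;> cases y <;>
    simp [Pauli.mat, Pauli.mul, Pauli.phase, Matrix.mul_apply]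

lemma Pauli.mat_comm (p q : Pauli) :
    p.mat * q.mat = (p.sign q : ℂ) • (q.mat * p.mat) := by
  ext x y
  cases p <;> cases q <;> cases x <;> cases y <;>
    simp [Pauli.mat, Pauli.sign, Matrix.mul_apply]

lemma Pauli.mat_self_adjoint (p : Pauli) (x y : Bool) : star (p.mat x y) = p.mat y x := by
  cases p <;> cases x <;> cases y <;> simp [Pauli.mat]

lemma pauliString_mul (w v : ι → Pauli) :
    pauliString w * pauliString v =
      Complex.I ^ (∑ i, (w i).phase (v i)) • pauliString fun i => (w i).mul (v i) := by
  ext x y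
  rw [pauliString_mul_apply]
  simp [Pauli.mat_mul, Finset.prod_mul_distrib, Finset.prod_pow_eq_pow_sum, pauliString]

lemma pauliString_comm (w v : ι → Pauli) :
    pauliString w * pauliString v =
      ((∏ i, (w i).sign (v i) : ℤ) : ℂ) • (pauliString v * pauliString w) := by
  ext x y
  rw [pauliString_mul_apply, Matrix.smul_apply, pauliString_mul_apply]
  simp only [Pauli.mat_comm (w _) (v _)]
  simp [Finset.prod_mul_distrib]

omit [DecidableEq ι] in
lemma prod_sign_eq (w v : ι → Pauli) :
    ∏ i, (w i).sign (v i) = 1 ∨ ∏ i, (w i).sign (v i) = -1 := by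
  refine Finset.prod_induction _ (fun s : ℤ => s = 1 ∨ s = -1) ?_ (Or.inl rfl) ?_
  · rintro _ _ (rfl | rfl) (rfl | rfl) <;> simp
  · intro i _
    unfold Pauli.sign
    split_ifs <;> simp

lemma pauliString_commute_or_anticommute (w v : ι → Pauli) :
    pauliString w * pauliString v = pauliString v * pauliString w ∨
      pauliString w * pauliString v = -(pauliString v * pauliString w) := by
  rcases prod_sign_eq w v with h | h
  · left; rw [pauliString_comm, h]; simp
  · right; rw [pauliString_comm, h]; simp

omit [DecidableEq ι] in
lemma star_pauliString (w : ι → Pauli) : star (pauliString w) = pauliString w := by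
  ext x y
  simp only [Matrix.star_apply, pauliString, Matrix.of_apply]
  rw [star_prod]
  simp only [Pauli.mat_self_adjoint]

lemma pauliString_mul_self (w : ι → Pauli) : pauliString w * pauliString w = 1 := by
  have h := Matrix.mem_unitaryGroup_iff.mp (pauliString_mem_unitaryGroup w)
  rwa [star_pauliString] at h

/-- Two non-identity Pauli strings have a common anticommuting Pauli string. -/
lemma exists_anticommuting (w v : ι → Pauli) (hw : w ≠ fun _ => .I) (hv : v ≠ fun _ => .I) :
    ∃ u : ι → Pauli, pauliString w * pauliString u = -(pauliString u * pauliString w) ∧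
      pauliString v * pauliString u = -(pauliString u * pauliString v) := by
  have key : ∃ u : ι → Pauli, ∏ i, (w i).sign (u i) = -1 ∧ ∏ i, (v i).sign (u i) = -1 := by
    have hsite : ∀ p q : Pauli, p ≠ .I → q ≠ .I → ∃ r : Pauli, p.sign r = -1 ∧ q.sign r = -1 := by
      decide
    have hI : ∀ p : Pauli, p.sign .I = 1 := by decide
    have hI' : ∀ p : Pauli, Pauli.sign .I p = 1 := by decide
    -- If the supports meet, one site suffices, since any two non-identity Pauli matrices have a
    -- common anticommuting one. If they are disjoint, one site from each support is used.
    by_cases hcap : ∃ i, w i ≠ .I ∧ v i ≠ .I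
    · obtain ⟨i, hi, hi'⟩ := hcap
      obtain ⟨r, hr, hr'⟩ := hsite _ _ hi hi'
      refine ⟨fun j => if j = i then r else .I, ?_, ?_⟩
      · rw [Finset.prod_eq_single i (fun j _ hj => by simp [hj, hI]) (by simp)]
        simpa using hr
      · rw [Finset.prod_eq_single i (fun j _ hj => by simp [hj, hI]) (by simp)]
        simpa using hr'
    · push Not at hcap
      obtain ⟨i, hi⟩ := Function.ne_iff.mp hw
      obtain ⟨j, hj⟩ := Function.ne_iff.mp hv
      have hvi := hcap i hi
      have hwj : w j = .I := by
        by_contra h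
        exact hj (hcap j h)
      have hij : i ≠ j := by
        rintro rfl
        exact hi hwj
      obtain ⟨r, hr, -⟩ := hsite _ _ hi hi
      obtain ⟨s, hs, -⟩ := hsite _ _ hj hj
      refine ⟨fun a => if a = i then r else if a = j then s else .I, ?_, ?_⟩
      · rw [Finset.prod_eq_single i (fun a _ ha => ?_) (by simp)]
        · simpa using hr
        · by_cases haj : a = j
          · subst haj; simp [hwj, hI']
          · simp [ha, haj, hI]
      · rw [Finset.prod_eq_single j (fun a _ ha => ?_) (by simp)]
        · simpa [hij.symm] using hs
        · by_cases hai : a = i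
          · subst hai; simp [hvi, hI']
          · simp [ha, hai, hI]
  obtain ⟨u, h1, h2⟩ := key
  refine ⟨u, ?_, ?_⟩
  · rw [pauliString_comm, h1]; simp
  · rw [pauliString_comm, h2]; simp

/-! ### Clifford unitaries acting on Pauli strings -/

lemma smul_pauliString_mem_pauliGroup {U : UnitaryOp ι} (s : ℕ) (w : ι → Pauli)
    (h : (U : Op ι) = Complex.I ^ s • pauliString w) : U ∈ pauliGroup ι := by
  refine ⟨⟨s % 4, Nat.mod_lt _ (by norm_num)⟩, w, ?_⟩
  rw [h, Complex.I_pow_eq_pow_mod s]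

/-- The multiples `i ^ s P` of Pauli strings, as operators. -/
def IsPhasedPauli (A : Op ι) : Prop := ∃ (s : ℕ) (w : ι → Pauli), A = Complex.I ^ s • pauliString w

lemma IsPhasedPauli.mul {A B : Op ι} (hA : IsPhasedPauli A) (hB : IsPhasedPauli B) :
    IsPhasedPauli (A * B) := by
  obtain ⟨s, w, rfl⟩ := hA
  obtain ⟨t, v, rfl⟩ := hB
  refine ⟨s + t + ∑ i, (w i).phase (v i), fun i => (w i).mul (v i), ?_⟩
  rw [Matrix.smul_mul, Matrix.mul_smul, pauliString_mul, smul_smul, smul_smul, pow_add, pow_add,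
    mul_assoc]

omit [DecidableEq ι] in
lemma isPhasedPauli_pauliString (w : ι → Pauli) : IsPhasedPauli (pauliString w) :=
  ⟨0, w, by simp⟩

omit [DecidableEq ι] in
lemma IsPhasedPauli.smul {A : Op ι} (hA : IsPhasedPauli A) (s : ℕ) :
    IsPhasedPauli (Complex.I ^ s • A) := by
  obtain ⟨t, w, rfl⟩ := hA
  exact ⟨s + t, w, by rw [smul_smul, pow_add]⟩

omit [DecidableEq ι] in
lemma IsPhasedPauli.neg {A : Op ι} (hA : IsPhasedPauli A) : IsPhasedPauli (-A) := by
  simpa using hA.smul 2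

lemma mem_pauliGroup_iff (U : UnitaryOp ι) : U ∈ pauliGroup ι ↔ IsPhasedPauli (U : Op ι) :=
  ⟨fun ⟨k, w, h⟩ => ⟨k, w, h⟩, fun ⟨s, w, h⟩ => smul_pauliString_mem_pauliGroup s w h⟩

/-- For anticommuting Pauli strings `P` and `R`, the operator `(P + R) / √2` is a Clifford unitary
that exchanges `P` and `R`. -/
lemma exists_clifford_swap (w u : ι → Pauli)
    (h : pauliString w * pauliString u = -(pauliString u * pauliString w)) :
    ∃ V ∈ cliffordUnitaries ι, star (V : Op ι) * pauliString w * (V : Op ι) = pauliString u := by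
  set P := pauliString w with hP
  set R := pauliString u with hR
  have hPP : P * P = 1 := pauliString_mul_self w
  have hRR : R * R = 1 := pauliString_mul_self u
  let c : ℂ := ((Real.sqrt 2)⁻¹ : ℝ)
  have hcc : c * c = 1 / 2 := by
    have : (Real.sqrt 2)⁻¹ * (Real.sqrt 2)⁻¹ = (1 / 2 : ℝ) := by
      rw [← mul_inv, Real.mul_self_sqrt (by norm_num)]; norm_num
    simp only [c, ← Complex.ofReal_mul, this]
    norm_num
  obtain ⟨W, hW⟩ : ∃ W : Op ι, W = c • (P + R) := ⟨_, rfl⟩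
  have hconj : ∀ A : Op ι, W * A * W = (1 / 2 : ℂ) • ((P + R) * A * (P + R)) := by
    intro A
    simp only [hW, Matrix.smul_mul, Matrix.mul_smul, smul_smul, hcc]
  have hstar : star W = W := by
    simp only [hW, star_smul, star_add, hP, hR, star_pauliString]
    congr 1
    exact Complex.conj_ofReal _
  have hWW : W * W = 1 := by
    have h1 := hconj 1
    rw [mul_one, mul_one] at h1
    rw [h1, add_mul, mul_add, mul_add, hPP, hRR, h]
    rw [show (1 + -(R * P) + (R * P + 1) : Op ι) = (2 : ℂ) • (1 : Op ι) by
      rw [two_smul]; abel, smul_smul]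
    norm_num
  let V : UnitaryOp ι := ⟨W, Matrix.mem_unitaryGroup_iff.mpr (by rw [hstar, hWW])⟩
  -- For a Pauli string `Q`, expand `(P + R) Q (P + R)`. If `Q` commutes with both or anticommutes
  -- with both, the cross terms cancel by `P R = -R P` and `±2 Q` remains. Otherwise `P Q P` and `R
  -- Q R` cancel, and the two cross terms both equal `P Q R`.
  have hpres : ∀ A : Op ι, IsPhasedPauli A → IsPhasedPauli (W * A * W) := by
    rintro _ ⟨s, v, rfl⟩
    have hQ := isPhasedPauli_pauliString v
    have hPi : IsPhasedPauli P := isPhasedPauli_pauliString w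
    have hRi : IsPhasedPauli R := isPhasedPauli_pauliString u
    rw [Matrix.mul_smul, Matrix.smul_mul]
    suffices hs : IsPhasedPauli (W * pauliString v * W) from hs.smul s
    rw [hconj (pauliString v)]
    have expand : ∀ (Q : Op ι), (P + R) * Q * (P + R)
        = P * Q * P + P * Q * R + R * Q * P + R * Q * R := by
      intro Q; noncomm_ring
    rw [expand]
    set Q := pauliString v
    have two : ∀ A : Op ι, (1 / 2 : ℂ) • (A + A) = A := by
      intro A
      rw [← two_smul ℂ A, smul_smul]; norm_num
    rcases pauliString_commute_or_anticommute w v with h1 | h1 <;>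
      rcases pauliString_commute_or_anticommute u v with h2 | h2 <;>
      change P * Q = _ at h1 <;> change R * Q = _ at h2
    · have : P * Q * P + P * Q * R + R * Q * P + R * Q * R = Q + Q := by
        rw [h1, h2, mul_assoc Q P P, hPP, mul_assoc Q R R, hRR, mul_assoc Q P R, h,
          mul_assoc Q R P]
        noncomm_ring
      rw [this, two]; exact hQ
    · have : P * Q * P + P * Q * R + R * Q * P + R * Q * R = P * Q * R + P * Q * R := by
        have e1 : P * Q * P = Q := by rw [h1, mul_assoc, hPP, mul_one]
        have e2 : R * Q * R = -Q := by rw [h2, neg_mul, mul_assoc, hRR, mul_one]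
        have e3 : R * Q * P = P * Q * R := by
          rw [h2, neg_mul, mul_assoc, h1, mul_assoc, h, mul_neg]
        rw [e1, e2, e3]; abel
      rw [this, two]; exact (hPi.mul hQ).mul hRi
    · have : P * Q * P + P * Q * R + R * Q * P + R * Q * R = P * Q * R + P * Q * R := by
        have e1 : P * Q * P = -Q := by rw [h1, neg_mul, mul_assoc, hPP, mul_one]
        have e2 : R * Q * R = Q := by rw [h2, mul_assoc, hRR, mul_one]
        have e3 : R * Q * P = P * Q * R := by
          rw [h2, mul_assoc, h1, neg_mul, mul_assoc, h, mul_neg, neg_neg]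
        rw [e1, e2, e3]; abel
      rw [this, two]; exact (hPi.mul hQ).mul hRi
    · have : P * Q * P + P * Q * R + R * Q * P + R * Q * R = -Q + -Q := by
        rw [h1, h2]
        simp only [neg_mul]
        rw [mul_assoc Q P P, hPP, mul_assoc Q R R, hRR, mul_assoc Q P R, h,
          mul_assoc Q R P]
        noncomm_ring
      rw [this, two]; exact hQ.neg
  have hinv : (V⁻¹ : UnitaryOp ι) = V := by
    apply Subtype.ext
    rw [Matrix.UnitaryGroup.inv_val]
    exact hstar
  refine ⟨V, ?_, ?_⟩
  · refine Subgroup.mem_set_normalizer_iff.mpr fun A => ?_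
    rw [hinv, mem_pauliGroup_iff, mem_pauliGroup_iff]
    refine ⟨hpres _, fun hA => ?_⟩
    -- `W` is an involution, so conjugating once more gives the converse inclusion.
    have h2 := hpres _ hA
    have e : W * ((V * A * V : UnitaryOp ι) : Op ι) * W = A := by
      change W * (W * A * W) * W = A
      rw [show W * (W * (A : Op ι) * W) * W = (W * W) * A * (W * W) by noncomm_ring, hWW,
        one_mul, mul_one]
    rwa [e] at h2
  · change star W * P * W = R
    rw [hstar, hconj]
    have : (P + R) * P * (P + R) = R + R := by
      rw [show (P + R) * P * (P + R) = P * P * P + P * P * R + R * (P * P) + R * (P * R) by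
        noncomm_ring, hPP, h, mul_neg, ← mul_assoc, hRR]
      noncomm_ring
    rw [this, ← two_smul ℂ R, smul_smul]
    norm_num

/-- The Clifford group acts transitively on the non-identity Pauli strings. -/
lemma exists_clifford_conj (w v : ι → Pauli) (hw : w ≠ fun _ => .I) (hv : v ≠ fun _ => .I) :
    ∃ V ∈ cliffordUnitaries ι, star (V : Op ι) * pauliString w * (V : Op ι) = pauliString v := by
  -- The swap needs anticommuting strings, and `w`, `v` may commute; hence the detour through `u`.
  obtain ⟨u, hwu, hvu⟩ := exists_anticommuting w v hw hv
  obtain ⟨V, hV, hV'⟩ := exists_clifford_swap w u hwu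
  obtain ⟨V₂, hV₂, hV₂'⟩ := exists_clifford_swap u v (by rw [hvu, neg_neg])
  refine ⟨V * V₂, mul_mem hV hV₂, ?_⟩
  rw [← hV₂', ← hV']
  simp [mul_assoc]

/-! ### Completeness relations -/

/-- On one site the sum of `p ⊗ p` over the four Pauli matrices is twice the swap. The product over
the sites is `2 ^ card ι` times the global swap, and contracting one factor with `A` returns `A`. -/
lemma sum_trace_pauliString_smul (A : Op ι) :
    ∑ w : ι → Pauli, (pauliString w * A).trace • pauliString w
      = (2 : ℂ) ^ Fintype.card ι • A := by
  have hsite : ∀ a b c d : Bool, ∑ p : Pauli, p.mat a b * p.mat c d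
      = if b = c ∧ a = d then 2 else 0 := by
    intro a b c d
    have huniv : (Finset.univ : Finset Pauli) = {.I, .X, .Y, .Z} := rfl
    rw [huniv]
    cases a <;> cases b <;> cases c <;> cases d <;> simp [Pauli.mat] <;> norm_num
  have hglobal : ∀ a b c d : Bits ι, ∑ w : ι → Pauli, pauliString w a b * pauliString w c d
      = if b = c ∧ a = d then (2 : ℂ) ^ Fintype.card ι else 0 := by
    intro a b c d
    simp only [pauliString, Matrix.of_apply, ← Finset.prod_mul_distrib]
    rw [← Fintype.piFinset_univ]
    refine (Finset.prod_univ_sum (fun _ => Finset.univ)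
      fun i (p : Pauli) => p.mat (a i) (b i) * p.mat (c i) (d i)).symm.trans ?_
    simp only [hsite]
    rw [Finset.prod_ite_zero]
    simp [funext_iff, forall_and]
  ext x y
  simp only [Matrix.sum_apply, Matrix.smul_apply, smul_eq_mul, Matrix.trace, Matrix.diag_apply,
    Matrix.mul_apply, Finset.sum_mul]
  rw [Finset.sum_comm]
  simp_rw [Finset.sum_comm (s := (Finset.univ : Finset (ι → Pauli)))]
  have : ∀ a b, ∑ w : ι → Pauli, pauliString w a b * A b a * pauliString w x y
      = (if b = x ∧ a = y then (2 : ℂ) ^ Fintype.card ι else 0) * A b a := by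
    intro a b
    rw [← hglobal a b x y, Finset.sum_mul]
    exact Finset.sum_congr rfl fun w _ => by ring
  simp_rw [this]
  rw [Finset.sum_eq_single y, Finset.sum_eq_single x] <;> simp +contextual

/-- The labels of the Pauli strings with factors `I` and `Z` only. -/
def diagonalStrings (ι : Type) [Fintype ι] [DecidableEq ι] : Finset (ι → Pauli) :=
  Fintype.piFinset fun _ => {.I, .Z}

lemma card_diagonalStrings : (diagonalStrings ι).card = 2 ^ Fintype.card ι := by
  simp [diagonalStrings, Fintype.card_piFinset]

/-- On one site `I ⊗ I + Z ⊗ Z` is twice the projection onto equal bits, so the `I`, `Z` strings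
implement dephasing in the computational basis. -/
lemma sum_diagonalStrings (A : Op ι) :
    ∑ w ∈ diagonalStrings ι, (pauliString w * A).trace • pauliString w
      = (2 : ℂ) ^ Fintype.card ι • Matrix.diagonal fun b => A b b := by
  have hsite : ∀ a b c d : Bool, ∑ p ∈ {Pauli.I, Pauli.Z}, p.mat a b * p.mat c d
      = if b = a ∧ c = d ∧ a = c then 2 else 0 := by
    intro a b c d
    cases a <;> cases b <;> cases c <;> cases d <;> simp [Pauli.mat] <;> norm_num
  have hglobal : ∀ a b c d : Bits ι,
      ∑ w ∈ diagonalStrings ι, pauliString w a b * pauliString w c d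
      = if b = a ∧ c = d ∧ a = c then (2 : ℂ) ^ Fintype.card ι else 0 := by
    intro a b c d
    simp only [pauliString, Matrix.of_apply, ← Finset.prod_mul_distrib]
    refine (Finset.prod_univ_sum (fun _ => {Pauli.I, Pauli.Z})
      fun i (p : Pauli) => p.mat (a i) (b i) * p.mat (c i) (d i)).symm.trans ?_
    simp only [hsite]
    rw [Finset.prod_ite_zero]
    simp [funext_iff, forall_and]
  ext x y
  simp only [Matrix.sum_apply, Matrix.smul_apply, smul_eq_mul, Matrix.trace, Matrix.diag_apply,
    Matrix.mul_apply, Finset.sum_mul]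
  rw [Finset.sum_comm]
  simp_rw [Finset.sum_comm (s := diagonalStrings ι)]
  have : ∀ a b, ∑ w ∈ diagonalStrings ι, pauliString w a b * A b a * pauliString w x y
      = (if b = a ∧ x = y ∧ a = x then (2 : ℂ) ^ Fintype.card ι else 0) * A b a := by
    intro a b
    rw [← hglobal a b x y, Finset.sum_mul]
    exact Finset.sum_congr rfl fun w _ => by ring
  simp_rw [this]
  rw [Finset.sum_eq_single x, Finset.sum_eq_single x]
  · by_cases hxy : x = y
    · subst hxy; simp
    · simp [hxy]
  all_goals simp +contextual [eq_comm]

end PauliAlgebra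

/-! ### The Clifford twirl and unbiasedness of the shadow -/

section CliffordTwirl

variable {ι : Type} [Fintype ι] [DecidableEq ι]

/-- Sums over a coset space of functions that are constant on cosets are invariant under left
multiplication. -/
lemma sum_quotient_out_mul_left {G M : Type*} [Group G] [AddCommMonoid M] (H : Subgroup G)
    [Fintype (G ⧸ H)] (g : G → M) (hg : ∀ x, ∀ p ∈ H, g (x * p) = g x) (v : G) :
    ∑ c : G ⧸ H, g (v * c.out) = ∑ c : G ⧸ H, g c.out := by
  rw [← Equiv.sum_comp (MulAction.toPerm v : Equiv.Perm (G ⧸ H)) fun c => g c.out]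
  refine Finset.sum_congr rfl fun c _ => ?_
  have h1 : v • c = ((v * c.out : G) : G ⧸ H) := by
    conv_lhs => rw [← QuotientGroup.out_eq' c]
    rfl
  -- The chosen representative of `v • c` differs from `v * c.out` by a right factor in `H`, which
  -- `g` ignores.
  obtain ⟨p, hp⟩ := QuotientGroup.mk_out_eq_mul H (v * c.out)
  rw [MulAction.toPerm_apply, h1, hp, hg _ _ p.2]

/-- Averages over the Clifford group of functions insensitive to the global phase are invariant
under left multiplication. -/
lemma sum_clifford_mul_left {M : Type*} [AddCommMonoid M] (g : UnitaryOp ι → M)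
    (hg : ∀ U, ∀ p ∈ globalPhases ι, g (U * p) = g U) {V : UnitaryOp ι}
    (hV : V ∈ cliffordUnitaries ι) :
    ∑ c : Clifford ι, g (V * c.unitary) = ∑ c : Clifford ι, g c.unitary :=
  sum_quotient_out_mul_left _ (fun U : cliffordUnitaries ι => g U.1)
    (fun U p hp => hg U.1 p.1 (Subgroup.mem_subgroupOf.mp hp)) ⟨V, hV⟩

/-- The summand of the Clifford twirl of `A` that belongs to the operator `P`. -/
def twirlTerm (A P : Op ι) (U : UnitaryOp ι) : Op ι :=
  (P * (U.1 * A * star U.1)).trace • (star U.1 * P * U.1)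

/-- Each factor contains the unitary and its adjoint once, so a phase `c` enters only through `c *
star c = 1`. Sums over Clifford classes thus do not depend on the representatives. -/
lemma twirlTerm_mul_phase (A P : Op ι) (U p : UnitaryOp ι) (hp : p ∈ globalPhases ι) :
    twirlTerm A P (U * p) = twirlTerm A P U := by
  obtain ⟨c, hc⟩ := hp
  have hcc : star c * c = 1 := by
    have h := Matrix.UnitaryGroup.star_mul_self p
    rw [hc, star_smul, star_one, Matrix.smul_mul, Matrix.mul_smul, smul_smul, one_mul] at h
    have h' := congrFun (congrFun h fun _ => false) fun _ => false
    simpa using h'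
  have hcc' : c * star c = 1 := by rw [mul_comm, hcc]
  have e1 : (U * p).1 = c • U.1 := by
    change U.1 * p.1 = _
    rw [hc, Matrix.mul_smul, mul_one]
  simp only [twirlTerm, e1, star_smul, Matrix.smul_mul, Matrix.mul_smul, smul_smul]
  rw [hcc, hcc', one_smul, mul_one]

/-- Turns a translation of the Clifford sum into a change of Pauli string, so that transitivity
applies. -/
lemma twirlTerm_mul_left (A P : Op ι) (V U : UnitaryOp ι) :
    twirlTerm A P (V * U) = twirlTerm A (star V.1 * P * V.1) U := by
  have e : (V * U).1 = V.1 * U.1 := rfl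
  simp only [twirlTerm, e, star_mul]
  congr 1
  · rw [show P * (V.1 * U.1 * A * (star U.1 * star V.1))
      = (P * (V.1 * (U.1 * A * star U.1))) * star V.1 by simp only [mul_assoc],
      Matrix.trace_mul_comm]
    simp only [mul_assoc]
  · simp only [mul_assoc]

lemma sum_twirlTerm_eq (A : Op ι) (w v : ι → Pauli) (hw : w ≠ fun _ => .I)
    (hv : v ≠ fun _ => .I) :
    ∑ c : Clifford ι, twirlTerm A (pauliString w) c.unitary
      = ∑ c : Clifford ι, twirlTerm A (pauliString v) c.unitary := by
  obtain ⟨V, hV, h⟩ := exists_clifford_conj w v hw hv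
  rw [← sum_clifford_mul_left _ (fun U p hp => twirlTerm_mul_phase A _ U p hp) hV]
  simp only [twirlTerm_mul_left, h]

lemma twirlTerm_one (A : Op ι) (U : UnitaryOp ι) : twirlTerm A 1 U = A.trace • (1 : Op ι) := by
  rw [twirlTerm, one_mul, Matrix.trace_mul_comm, ← mul_assoc, mul_one,
    Matrix.UnitaryGroup.star_mul_self, one_mul]

lemma star_mul_conj_mul (A : Op ι) (U : UnitaryOp ι) :
    star U.1 * (U.1 * A * star U.1) * U.1 = A := by
  rw [show star U.1 * (U.1 * A * star U.1) * U.1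
    = (star U.1 * U.1) * A * (star U.1 * U.1) by simp only [mul_assoc],
    Matrix.UnitaryGroup.star_mul_self, one_mul, mul_one]

lemma sum_twirlTerm_pauli (A : Op ι) (U : UnitaryOp ι) :
    ∑ w : ι → Pauli, twirlTerm A (pauliString w) U = (2 : ℂ) ^ Fintype.card ι • A := by
  have h := congrArg (fun X => star U.1 * X * U.1)
    (sum_trace_pauliString_smul (U.1 * A * star U.1))
  simp only [Finset.mul_sum, Finset.sum_mul, Matrix.mul_smul, Matrix.smul_mul,
    star_mul_conj_mul] at h
  exact h

lemma diagonal_eq_sum_outer (a : Bits ι → ℂ) :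
    Matrix.diagonal a = ∑ b, a b • outer (ket b) := by
  ext x y
  simp only [Matrix.sum_apply, Matrix.smul_apply, outer, ket, Matrix.vecMulVec_apply,
    Pi.star_apply, smul_eq_mul, Matrix.diagonal_apply]
  rw [Finset.sum_eq_single x]
  · by_cases h : x = y
    · subst h; simp
    · simp [h, Ne.symm h]
  · intro b _ hb
    simp [Pi.single_apply, Ne.symm hb]
  · simp

/-- The Clifford twirl of the measurement in the computational basis. -/
lemma sum_clifford_measure [Nonempty ι] (A : Op ι) :
    ∑ c : Clifford ι, ∑ b, (c.unitary.1 * A * star c.unitary.1) b b •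
        (star c.unitary.1 * outer (ket b) * c.unitary.1)
      = ((Fintype.card (Clifford ι) : ℂ) / ((2 : ℂ) ^ Fintype.card ι + 1)) •
        (A + A.trace • (1 : Op ι)) := by
  set d : ℂ := (2 : ℂ) ^ Fintype.card ι with hd
  set N : ℂ := (Fintype.card (Clifford ι) : ℂ) with hN
  have hdn : d = ((2 ^ Fintype.card ι : ℕ) : ℂ) := by simp [hd]
  -- A nonempty register gives `d > 1`, which permits division by `d - 1`.
  have hcard : 1 < 2 ^ Fintype.card ι := Nat.one_lt_two_pow Fintype.card_ne_zero
  have hd0 : d ≠ 0 := by simp [hd]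
  have hd1 : d - 1 ≠ 0 := by
    rw [hdn, sub_ne_zero]
    exact_mod_cast hcard.ne'
  have hd2 : d + 1 ≠ 0 := by
    rw [hdn]
    exact Nat.cast_add_one_ne_zero _
  let K : (ι → Pauli) → Op ι := fun w => ∑ c : Clifford ι, twirlTerm A (pauliString w) c.unitary
  let e : ι → Pauli := fun _ => .I
  have hKe : K e = (N * A.trace) • (1 : Op ι) := by
    simp only [K, e, pauliString_one, twirlTerm_one, Finset.sum_const, Finset.card_univ, mul_smul,
      hN, Nat.cast_smul_eq_nsmul]
  have hKall : ∑ w, K w = (N * d) • A := by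
    simp only [K]
    rw [Finset.sum_comm]
    simp only [sum_twirlTerm_pauli, Finset.sum_const, Finset.card_univ, mul_smul, hN,
      Nat.cast_smul_eq_nsmul, hd]
  have hpauli : (Fintype.card (ι → Pauli) : ℂ) = d * d := by
    have : Fintype.card Pauli = 4 := rfl
    rw [Fintype.card_fun, this, hd, ← mul_pow]
    norm_num
  -- The `d ^ 2 - 1` non-identity strings share one value of `K`; subtracting `K e` from the full
  -- sum determines it.
  have hK : ∀ w, w ≠ e → K w = (N / ((d - 1) * (d + 1))) • (d • A - A.trace • (1 : Op ι)) := by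
    intro w hw
    have : Nonempty (ι → Pauli) := ⟨w⟩
    have h1 : ∑ v ∈ Finset.univ.erase e, K v = (d * d - 1) • K w := by
      rw [Finset.sum_congr rfl fun v hv => sum_twirlTerm_eq A v w (Finset.ne_of_mem_erase hv) hw,
        Finset.sum_const, Finset.card_erase_of_mem (Finset.mem_univ _), Finset.card_univ,
        ← Nat.cast_smul_eq_nsmul ℂ, Nat.cast_sub Fintype.card_pos, hpauli, Nat.cast_one]
    have h2 := Finset.add_sum_erase Finset.univ K (Finset.mem_univ e)
    rw [h1, hKall, hKe] at h2
    have h3 : (d * d - 1) • K w = N • (d • A - A.trace • (1 : Op ι)) := by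
      rw [smul_sub, smul_smul, smul_smul, ← h2]
      abel
    have h4 : K w = (d * d - 1)⁻¹ • ((d * d - 1) • K w) := by
      rw [smul_smul, inv_mul_cancel₀, one_smul]
      rw [show d * d - 1 = (d - 1) * (d + 1) by ring]
      exact mul_ne_zero hd1 hd2
    rw [h4, h3, smul_smul]
    congr 1
    rw [show d * d - 1 = (d - 1) * (d + 1) by ring]
    field_simp
  have hdiag : ∀ c : Clifford ι, ∑ b, (c.unitary.1 * A * star c.unitary.1) b b •
        (star c.unitary.1 * outer (ket b) * c.unitary.1)
      = d⁻¹ • ∑ w ∈ diagonalStrings ι, twirlTerm A (pauliString w) c.unitary := by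
    intro c
    have h := congrArg (fun X => star c.unitary.1 * X * c.unitary.1)
      (sum_diagonalStrings (c.unitary.1 * A * star c.unitary.1))
    rw [diagonal_eq_sum_outer] at h
    simp only [Finset.mul_sum, Finset.sum_mul, Matrix.mul_smul, Matrix.smul_mul] at h
    simp only [twirlTerm]
    rw [h, smul_smul, inv_mul_cancel₀ hd0, one_smul]
  simp only [hdiag]
  rw [← Finset.smul_sum, Finset.sum_comm]
  change d⁻¹ • ∑ w ∈ diagonalStrings ι, K w = _
  have he : e ∈ diagonalStrings ι := by simp [diagonalStrings, e]
  -- Among the `d` diagonal strings one is the identity and `d - 1` are not, so the factor `d - 1`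
  -- cancels.
  rw [← Finset.add_sum_erase _ K he, hKe,
    Finset.sum_congr rfl fun v hv => hK v (Finset.ne_of_mem_erase hv), Finset.sum_const,
    Finset.card_erase_of_mem he, card_diagonalStrings, ← Nat.cast_smul_eq_nsmul ℂ,
    Nat.cast_sub hcard.le, ← hdn, Nat.cast_one]
  ext x y
  simp only [Matrix.smul_apply, Matrix.add_apply, Matrix.sub_apply, smul_eq_mul]
  field_simp
  ring

/-- The mean value of `tr (B σ)` for the classical shadow `σ` of a state `A` is `tr (B A)`. -/
lemma sum_clifford_shadow [Nonempty ι] (A B : Op ι) (hA : A.trace = 1) :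
    ∑ c : Clifford ι, ∑ b, (c.unitary.1 * A * star c.unitary.1) b b *
        (B * cliffordShadow c.unitary b).trace
      = (Fintype.card (Clifford ι) : ℂ) * (B * A).trace := by
  have hd2 : (2 : ℂ) ^ Fintype.card ι + 1 ≠ 0 := by
    exact_mod_cast Nat.succ_ne_zero (2 ^ Fintype.card ι)
  have h := congrArg (fun X => (((2 : ℂ) ^ Fintype.card ι + 1) • (B * X)).trace)
    (sum_clifford_measure A)
  simp only [Finset.mul_sum, Matrix.mul_smul, hA, one_smul, Matrix.trace_smul, Matrix.trace_sum,
    mul_add, mul_one, Matrix.trace_add, smul_eq_mul] at h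
  -- Since the outcome weights sum to `1`, the `-1` in the shadow contributes `-tr B` for each
  -- Clifford and cancels the `tr A` term of the twirl.
  have hone : ∀ c : Clifford ι, ∑ b, (c.unitary.1 * A * star c.unitary.1) b b = 1 := by
    intro c
    change (c.unitary.1 * A * star c.unitary.1).trace = 1
    rw [Matrix.trace_mul_comm, ← mul_assoc, Matrix.UnitaryGroup.star_mul_self, one_mul, hA]
  simp only [cliffordShadow, mul_sub, mul_one, Matrix.mul_smul, Matrix.trace_sub,
    Matrix.trace_smul, smul_eq_mul, Finset.sum_sub_distrib, ← Finset.sum_mul, hone, one_mul,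
    Finset.sum_const, Finset.card_univ, nsmul_eq_mul]
  have h' : ∀ c : Clifford ι, ∀ b, (c.unitary.1 * A * star c.unitary.1) b b *
      (((2 : ℂ) ^ Fintype.card ι + 1) * (B * (star c.unitary.1 * outer (ket b) *
        c.unitary.1)).trace)
      = ((2 : ℂ) ^ Fintype.card ι + 1) * ((c.unitary.1 * A * star c.unitary.1) b b *
        (B * (star c.unitary.1 * outer (ket b) * c.unitary.1)).trace) := fun _ _ => by ring
  simp only [← Finset.mul_sum] at h
  simp only [h', ← Finset.mul_sum]
  rw [h]
  field_simp
  ring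

end CliffordTwirl

/-! ### The expected shadow overlap as a trace -/

section Expectation

open MeasureTheory

/-- Integrability is carried along with the value so that the statement can be iterated through the
four random choices of the protocol. -/
lemma integrable_integral_bind {α : Type*} [Fintype α] (p : PMF α) (f : α → PMF ℝ) (g : α → ℝ)
    (hf : ∀ a, Integrable (fun x => x) (f a).toMeasure ∧ ∫ x, x ∂(f a).toMeasure = g a) :
    Integrable (fun x => x) (p.bind f).toMeasure ∧
      ∫ x, x ∂(p.bind f).toMeasure = ∑ a, (p a).toReal * g a := by
  have h : (p.bind f).toMeasure = ∑ a, p a • (f a).toMeasure := by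
    ext s hs
    rw [PMF.toMeasure_bind_apply _ _ _ hs, tsum_fintype]
    simp [Measure.finsetSum_apply]
  have hint : ∀ a ∈ Finset.univ, Integrable (fun x : ℝ => x) (p a • (f a).toMeasure) :=
    fun a _ => (hf a).1.smul_measure (PMF.apply_ne_top p a)
  rw [h]
  refine ⟨integrable_finsetSum_measure.mpr hint, ?_⟩
  rw [integral_finsetSum_measure hint]
  refine Finset.sum_congr rfl fun a _ => ?_
  rw [integral_smul_measure, (hf a).2, smul_eq_mul]

lemma integrable_integral_pure (a : ℝ) :
    Integrable (fun x => x) (PMF.pure a).toMeasure ∧ ∫ x, x ∂(PMF.pure a).toMeasure = a := by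
  rw [PMF.toMeasure_pure]
  exact ⟨integrable_dirac (by simp), integral_dirac _ _⟩

variable {n : ℕ}

lemma DensityOp.measure_toReal {ι : Type} [Fintype ι] [DecidableEq ι] (ρ : DensityOp ι)
    (b : Bits ι) : (ρ.measure b).toReal = (ρ.mat b b).re := by
  simp only [DensityOp.measure, PMF.ofFintype_apply]
  exact ENNReal.toReal_ofReal (Complex.le_def.mp ρ.posSemidef.diag_nonneg).1

lemma PosSemidef.ofReal_re_diag {κ : Type*} {A : Matrix κ κ ℂ} (hA : A.PosSemidef)
    (b : κ) : ((A b b).re : ℂ) = A b b := by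
  have h := Complex.le_def.mp (hA.diag_nonneg (i := b))
  exact Complex.ext rfl (by simpa using h.2)

/-- The expected value of `tr (B σ)` for the classical shadow `σ` of `ρ`. -/
lemma sum_shadow_re {ι : Type} [Fintype ι] [DecidableEq ι] [Nonempty ι] (ρ : DensityOp ι)
    (B : Op ι) :
    ∑ c : Clifford ι, (PMF.uniformOfFintype (Clifford ι) c).toReal *
        ∑ b, ((ρ.conj c.unitary).measure b).toReal * (B * cliffordShadow c.unitary b).trace.re
      = (B * ρ.mat).trace.re := by
  have h := congrArg Complex.re (sum_clifford_shadow ρ.mat B ρ.trace_eq_one)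
  simp only [PMF.uniformOfFintype_apply, ENNReal.toReal_inv, ENNReal.toReal_natCast,
    ← Finset.mul_sum]
  have hN : (Fintype.card (Clifford ι) : ℝ) ≠ 0 := by
    exact_mod_cast Fintype.card_ne_zero
  rw [inv_mul_eq_iff_eq_mul₀ hN]
  rw [← Complex.ofReal_natCast, Complex.re_ofReal_mul] at h
  rw [← h, Complex.re_sum]
  refine Finset.sum_congr rfl fun c _ => ?_
  rw [Complex.re_sum]
  refine Finset.sum_congr rfl fun b _ => ?_
  rw [DensityOp.measure_toReal, ← Complex.re_ofReal_mul,
    PosSemidef.ofReal_re_diag (ρ.conj c.unitary).posSemidef]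
  rfl

lemma measureOutside_toReal (ρ : DensityOp (Fin n)) (k : Finset (Fin n))
    (z : Bits {i // i ∉ k}) : (measureOutside ρ k z).toReal = (block ρ k z).trace.re := by
  simp only [measureOutside, PMF.ofFintype_apply]
  exact ENNReal.toReal_ofReal (Complex.le_def.mp (block_posSemidef ρ k z).trace_nonneg).1

/-- For an outcome of probability zero the block is positive semidefinite of trace zero, hence zero,
so the arbitrary state chosen there is immaterial. -/
lemma trace_smul_postMeasurement (ρ : DensityOp (Fin n)) (k : Finset (Fin n))
    (z : Bits {i // i ∉ k}) :
    ((block ρ k z).trace.re : ℂ) • (postMeasurement ρ k z).mat = block ρ k z := by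
  have hre : ((block ρ k z).trace.re : ℂ) = (block ρ k z).trace :=
    Complex.ext rfl
      (by simpa using (Complex.le_def.mp (block_posSemidef ρ k z).trace_nonneg).2)
  rw [hre]
  unfold postMeasurement
  split_ifs with h
  · rw [h, zero_smul, ((block_posSemidef ρ k z).trace_eq_zero_iff).mp h]
  · change _ • (_ • _) = _
    rw [smul_smul, mul_inv_cancel₀ h, one_smul]

lemma trace_glue_mul (A : DensityOp (Fin n)) (k : Finset (Fin n)) (z : Bits {i // i ∉ k})
    (B : Op {i // i ∈ k}) :
    ((B ⊗ₖ outer (ket z)).submatrix (splitBits k) (splitBits k) * A.mat).trace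
      = (B * block A k z).trace := by
  simp only [Matrix.trace, Matrix.diag_apply, Matrix.mul_apply, Matrix.submatrix_apply]
  rw [← (splitBits k).symm.sum_comp]
  simp_rw [fun x => ((splitBits k).symm.sum_comp fun y =>
    (B ⊗ₖ outer (ket z)) (splitBits k x) (splitBits k y) * A.mat y x).symm]
  simp only [Equiv.apply_symm_apply, Fintype.sum_prod_type, Matrix.kroneckerMap_apply, outer, ket,
    Matrix.vecMulVec_apply, Pi.star_apply, block, Matrix.submatrix_apply, glue]
  refine Finset.sum_congr rfl fun l _ => ?_
  rw [Finset.sum_eq_single z]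
  · refine Finset.sum_congr rfl fun l' _ => ?_
    rw [Finset.sum_eq_single z]
    · simp
    · intro z' _ hz'
      simp [hz']
    · simp
  · intro z' _ hz'
    simp [hz']
  · simp

/-- The expected shadow overlap is `tr (L ρ)`. -/
theorem shadowOverlap_eq_trace (m : ℕ) (hm1 : 1 ≤ m) (hm : m ≤ n) (Ψ : Bits (Fin n) → ℂ)
    (ρ : DensityOp (Fin n)) :
    shadowOverlap m hm Ψ ρ = (overlapOperator m Ψ * ρ.mat).trace.re := by
  have h1 := fun (k : Finset (Fin n)) (z : Bits {i // i ∉ k}) (c : Clifford {i // i ∈ k}) =>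
    integrable_integral_bind ((postMeasurement ρ k z).conj c.unitary).measure
      (fun b => PMF.pure (localL Ψ k z * cliffordShadow c.unitary b).trace.re) _
      fun b => integrable_integral_pure _
  have h2 := fun (k : Finset (Fin n)) (z : Bits {i // i ∉ k}) =>
    integrable_integral_bind (PMF.uniformOfFintype (Clifford {i // i ∈ k})) _ _ (h1 k z)
  have h3 := fun (k : Finset (Fin n)) => integrable_integral_bind (measureOutside ρ k) _ _ (h2 k)
  have h4 := (integrable_integral_bind
    (PMF.uniformOfFinset (Finset.powersetCard m (Finset.univ : Finset (Fin n)))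
      (Finset.powersetCard_nonempty.mpr (by simpa using hm))) _ _ h3).2
  refine h4.trans ?_
  simp only [PMF.uniformOfFinset_apply, apply_ite ENNReal.toReal, ENNReal.toReal_zero, ite_mul,
    zero_mul, Finset.sum_ite_mem, Finset.univ_inter]
  simp only [Finset.card_powersetCard, Finset.card_univ, Fintype.card_fin, ENNReal.toReal_inv,
    ENNReal.toReal_natCast, overlapOperator, Matrix.smul_mul, Matrix.trace_smul, Finset.sum_mul,
    Matrix.trace_sum, trace_glue_mul, smul_eq_mul]
  rw [← Finset.mul_sum, ← Complex.ofReal_natCast, ← Complex.ofReal_inv, Complex.re_ofReal_mul,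
    Complex.re_sum]
  congr 1
  refine Finset.sum_congr rfl fun k hk => ?_
  have hkm : k.card = m := (Finset.mem_powersetCard.mp hk).2
  -- Here `1 ≤ m` enters: the twirl formula needs at least one qubit in `k`.
  have : Nonempty {i // i ∈ k} := by
    obtain ⟨i, hi⟩ := Finset.card_pos.mp (by omega : 0 < k.card)
    exact ⟨⟨i, hi⟩⟩
  rw [Complex.re_sum]
  refine Finset.sum_congr rfl fun z _ => ?_
  rw [sum_shadow_re, measureOutside_toReal, ← Complex.re_ofReal_mul, ← smul_eq_mul,
    ← Matrix.trace_smul, ← Matrix.mul_smul, trace_smul_postMeasurement]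

end Expectation

/-! ### Operator inequalities from a fixed vector and a spectral gap -/

section Spectral

variable {κ : Type*} [Fintype κ] [DecidableEq κ]

omit [DecidableEq κ] in
lemma trace_mul_vecMulVec (A : Matrix κ κ ℂ) (v w : κ → ℂ) :
    (A * Matrix.vecMulVec v w).trace = w ⬝ᵥ (A *ᵥ v) := by
  rw [Matrix.mul_vecMulVec, Matrix.trace_vecMulVec, dotProduct_comm]

omit [DecidableEq κ] in
-- Splitting `B` into rank-one terms reduces the trace to values of the quadratic form of `A`. This
-- converts operator inequalities into inequalities of expectations in `ρ`.
lemma trace_mul_re_nonneg {A B : Matrix κ κ ℂ} (hA : A.PosSemidef) (hB : B.PosSemidef) :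
    0 ≤ (A * B).trace.re := by
  obtain ⟨m, v, rfl⟩ := Matrix.posSemidef_iff_eq_sum_vecMulVec.mp hB
  rw [Finset.mul_sum, Matrix.trace_sum, Complex.re_sum]
  refine Finset.sum_nonneg fun i _ => ?_
  rw [trace_mul_vecMulVec]
  exact (Complex.le_def.mp (hA.dotProduct_mulVec_nonneg _)).1

/-- In a decreasing list only the head can exceed entry `1`, whereas `a` and `b`, counted with
multiplicity, would be two such elements. -/
lemma le_sort_getD_one {s : Multiset ℝ} {a b : ℝ} (hab : {a, b} ≤ s)
    (ha : (s.sort (· ≥ ·)).getD 1 0 < a) : b ≤ (s.sort (· ≥ ·)).getD 1 0 := by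
  by_contra! hb
  set μ := (s.sort (· ≥ ·)).getD 1 0 with hμ
  have h1 : 2 ≤ s.countP (μ < ·) := by
    refine le_trans ?_ (Multiset.countP_le_of_le _ hab)
    rw [Multiset.insert_eq_cons, Multiset.countP_cons_of_pos _ ha, ← Multiset.cons_zero,
      Multiset.countP_cons_of_pos _ hb]
    simp
  have hcard : 2 ≤ s.card := h1.trans (Multiset.countP_le_card _ _)
  rw [← Multiset.sort_eq s (· ≥ ·), Multiset.coe_countP] at h1
  have hlen := Multiset.length_sort (s := s) (r := (· ≥ ·))
  have hsorted := Multiset.pairwise_sort s (· ≥ ·)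
  generalize s.sort (· ≥ ·) = l at *
  match l, hlen with
  | [], h => simp at h; omega
  | [_], h => simp at h; omega
  | x :: y :: t, _ =>
    have hy : μ = y := by simp [hμ]
    have ht : ∀ u ∈ t, u ≤ y := fun u hu =>
      List.rel_of_pairwise_cons (List.Pairwise.of_cons hsorted) hu
    rw [List.countP_cons, List.countP_cons, List.countP_eq_zero.mpr fun u hu => by
      simpa [hy] using ht u hu] at h1
    simp only [hy, lt_irrefl, decide_false] at h1
    split_ifs at h1 <;> simp_all

/-- If a Hermitian matrix has the unit vector `v` as an eigenvector to the eigenvalue `1`, and its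
second largest eigenvalue `μ` is smaller than `1`, then it is at most `μ` on the orthogonal
complement of `v`. -/
lemma posSemidef_sub_of_gap {A : Matrix κ κ ℂ} (hA : A.IsHermitian) {v : κ → ℂ}
    (hAv : A *ᵥ v = v) (hv : star v ⬝ᵥ v = 1) {μ : ℝ}
    (hμ : ((A.charpoly.roots.map Complex.re).sort (· ≥ ·)).getD 1 0 = μ) (hμ1 : μ < 1) :
    ((μ : ℂ) • (1 - Matrix.vecMulVec v (star v)) + Matrix.vecMulVec v (star v) - A).PosSemidef := by
  set U : Matrix κ κ ℂ := (hA.eigenvectorUnitary : Matrix κ κ ℂ) with hU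
  set D : Matrix κ κ ℂ := Matrix.diagonal fun i => (hA.eigenvalues i : ℂ) with hD
  have hUU : U * star U = 1 := Unitary.coe_mul_star_self hA.eigenvectorUnitary
  have hUU' : star U * U = 1 := Unitary.coe_star_mul_self hA.eigenvectorUnitary
  have hspec : A = U * D * star U := by
    conv_lhs => rw [hA.spectral_theorem, Unitary.conjStarAlgAut_apply]
    rfl
  have hroots : A.charpoly.roots.map Complex.re = Finset.univ.val.map hA.eigenvalues := by
    rw [hA.roots_charpoly_eq_eigenvalues, Multiset.map_map]
    rfl
  rw [hroots] at hμ
  have hle : ∀ i j, i ≠ j → μ < hA.eigenvalues i → hA.eigenvalues j ≤ μ := by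
    intro i j hij hi
    rw [← hμ]
    refine le_sort_getD_one (a := hA.eigenvalues i) ?_ (by rwa [hμ])
    -- Distinct indices are compared, so that equal eigenvalues count twice.
    have hsub : ({i, j} : Multiset κ) ≤ Finset.univ.val := by
      refine (Multiset.le_iff_subset ?_).mpr fun x _ => Finset.mem_univ x
      simpa using hij
    simpa using Multiset.map_le_map hsub (f := hA.eigenvalues)
  set φ : κ → ℂ := star U *ᵥ v with hφ
  have hvφ : v = U *ᵥ φ := by rw [hφ, Matrix.mulVec_mulVec, hUU, Matrix.one_mulVec]
  have hDφ : D *ᵥ φ = φ := by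
    have h := congrArg (star U *ᵥ ·) hAv
    simp only [hspec, Matrix.mulVec_mulVec] at h
    rw [← mul_assoc, ← mul_assoc, hUU', one_mul, ← Matrix.mulVec_mulVec] at h
    exact h
  have hφi : ∀ i, φ i ≠ 0 → hA.eigenvalues i = 1 := by
    intro i hi
    have h := congrFun hDφ i
    rw [hD, Matrix.mulVec_diagonal] at h
    have h' := mul_right_cancel₀ hi (h.trans (one_mul _).symm)
    exact_mod_cast h'
  have hφnorm : star φ ⬝ᵥ φ = 1 := by
    rw [hφ, Matrix.star_mulVec, ← Matrix.dotProduct_mulVec, Matrix.mulVec_mulVec,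
      ← Matrix.star_eq_conjTranspose, star_star, hUU, Matrix.one_mulVec, hv]
  obtain ⟨i₀, hi₀⟩ : ∃ i, φ i ≠ 0 := by
    by_contra! h
    have : φ = 0 := funext h
    simp [this] at hφnorm
  have hi₀1 := hφi i₀ hi₀
  -- A second nonzero coordinate would give the eigenvalue `1` at two indices, hence `1 ≤ μ`. So `v`
  -- is an eigenbasis vector up to phase, and `|v⟩⟨v|` is diagonal in that basis.
  have hφ0 : ∀ i, i ≠ i₀ → φ i = 0 := by
    intro i hi
    by_contra h
    have := hle i₀ i hi.symm (by rwa [hi₀1])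
    rw [hφi i h] at this
    exact absurd hμ1 (not_lt.mpr this)
  have hφφ : Matrix.vecMulVec φ (star φ) = Matrix.diagonal fun i => if i = i₀ then 1 else 0 := by
    have h1 : φ i₀ * star (φ i₀) = 1 := by
      rw [← hφnorm, dotProduct, Finset.sum_eq_single i₀ (fun i _ hi => by simp [hφ0 i hi])
        (by simp), mul_comm, Pi.star_apply]
    ext i j
    rw [Matrix.vecMulVec_apply, Pi.star_apply, Matrix.diagonal_apply]
    by_cases hi : i = i₀
    · subst hi
      by_cases hj : i = j
      · subst hj; simpa using h1
      · simp [hj, hφ0 j (Ne.symm hj)]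
    · simp [hi, hφ0 i hi]
  have hvv : Matrix.vecMulVec v (star v) = U * Matrix.vecMulVec φ (star φ) * star U := by
    rw [Matrix.mul_vecMulVec, Matrix.vecMulVec_mul, ← hvφ, hvφ, Matrix.star_mulVec]
    rfl
  have hmain : (μ : ℂ) • (1 - Matrix.vecMulVec v (star v)) + Matrix.vecMulVec v (star v) - A
      = U * Matrix.diagonal (fun i => if i = i₀ then 0 else ((μ - hA.eigenvalues i : ℝ) : ℂ))
        * star U := by
    have hdiag : Matrix.diagonal (fun i => if i = i₀ then 0 else ((μ - hA.eigenvalues i : ℝ) : ℂ))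
        = (μ : ℂ) • (1 - Matrix.vecMulVec φ (star φ)) + Matrix.vecMulVec φ (star φ) - D := by
      rw [hφφ, hD]
      ext i j
      by_cases hij : i = j
      · subst hij
        by_cases hi : i = i₀
        · subst hi; simp [hi₀1]
        · simp [hi]
      · simp [hij]
    rw [hdiag, hvv]
    conv_lhs => rw [hspec, ← hUU]
    simp only [mul_sub, sub_mul, mul_add, add_mul, Matrix.mul_smul, Matrix.smul_mul, mul_one]
  rw [hmain]
  refine (Matrix.PosSemidef.diagonal fun i => ?_).mul_mul_conjTranspose_same U
  by_cases hi : i = i₀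
  · simp [hi]
  · have h := hle i₀ i (Ne.symm hi) (by rwa [hi₀1])
    simp only [Pi.zero_apply, hi, if_false]
    exact_mod_cast sub_nonneg.mpr h

/-- A positive semidefinite matrix is at least the projection onto a unit vector that it fixes. -/
lemma posSemidef_sub_vecMulVec {A : Matrix κ κ ℂ} (hA : A.PosSemidef) {v : κ → ℂ}
    (hAv : A *ᵥ v = v) (hv : star v ⬝ᵥ v = 1) :
    (A - Matrix.vecMulVec v (star v)).PosSemidef := by
  set q := Matrix.vecMulVec v (star v) with hq
  have hqstar : qᴴ = q := by rw [hq, Matrix.conjTranspose_vecMulVec, star_star]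
  have hAq : A * q = q := by rw [hq, Matrix.mul_vecMulVec, hAv]
  have hqA : q * A = q := by
    have h := congrArg Matrix.conjTranspose hAq
    rwa [Matrix.conjTranspose_mul, hqstar, hA.isHermitian.eq] at h
  have hqq : q * q = q := by
    conv_lhs => rw [hq, Matrix.vecMulVec_mul_vecMulVec, hv]
    simp [hq]
  have h := hA.conjTranspose_mul_mul_same (1 - q)
  -- Since `A` fixes `v`, removing `q` from `A` is compression by the complementary projection,
  -- which preserves positivity.
  have e : (1 - q)ᴴ * A * (1 - q) = A - q := by
    rw [Matrix.conjTranspose_sub, hqstar, Matrix.conjTranspose_one, sub_mul, one_mul, hqA, mul_sub,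
      mul_one, sub_mul, hAq, hqq]
    abel
  rwa [e] at h

end Spectral

/-! ### Spectral properties of `L` and its similarity to `P` -/

section OverlapOperator

variable {n : ℕ}

lemma overlapOperator_posSemidef (m : ℕ) (Ψ : Bits (Fin n) → ℂ) :
    (overlapOperator m Ψ).PosSemidef := by
  refine Matrix.PosSemidef.smul (Matrix.posSemidef_sum _ fun k _ =>
    Matrix.posSemidef_sum _ fun z _ => Matrix.PosSemidef.submatrix ?_ _) ?_
  · exact (Matrix.posSemidef_vecMulVec_self_star _).kronecker
      (Matrix.posSemidef_vecMulVec_self_star _)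
  · exact inv_nonneg_of_nonneg (Nat.cast_nonneg _)

lemma glue_splitBits (k : Finset (Fin n)) (x : Bits (Fin n)) :
    glue k (splitBits k x).2 (splitBits k x).1 = x :=
  (splitBits k).symm_apply_apply x

lemma sum_local_apply (Ψ : Bits (Fin n) → ℂ) (k : Finset (Fin n)) (x y : Bits (Fin n)) :
    (∑ z : Bits {i // i ∉ k},
      (localL Ψ k z ⊗ₖ outer (ket z)).submatrix (splitBits k) (splitBits k)) x y
      = if (splitBits k y).2 = (splitBits k x).2 then
        localL Ψ k (splitBits k x).2 (splitBits k x).1 (splitBits k y).1 else 0 := by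
  simp only [Matrix.sum_apply, Matrix.submatrix_apply, Matrix.kroneckerMap_apply, outer, ket,
    Matrix.vecMulVec_apply, Pi.star_apply]
  rw [Finset.sum_eq_single (splitBits k x).2]
  · by_cases h : (splitBits k y).2 = (splitBits k x).2
    · simp [h]
    · simp [h]
  · intro z _ hz
    simp [Pi.single_apply, Ne.symm hz]
  · simp

lemma localL_mulVec (Ψ : Bits (Fin n) → ℂ) (k : Finset (Fin n)) (z : Bits {i // i ∉ k}) :
    localL Ψ k z *ᵥ (fun l => Ψ (glue k z l)) = fun l => Ψ (glue k z l) := by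
  set N : ℝ := ∑ l', ‖Ψ (glue k z l')‖ ^ 2 with hN
  have hN0 : 0 ≤ N := Finset.sum_nonneg fun _ _ => by positivity
  have hNN : ((Real.sqrt N : ℝ) : ℂ) * (Real.sqrt N : ℝ) = N := by
    rw [← Complex.ofReal_mul, Real.mul_self_sqrt hN0]
  have hdot : star (collapsed Ψ k z) ⬝ᵥ (fun l => Ψ (glue k z l)) = (N : ℂ) / (Real.sqrt N : ℝ) := by
    rw [dotProduct, hN, Complex.ofReal_sum, Finset.sum_div]
    refine Finset.sum_congr rfl fun l _ => ?_
    simp only [collapsed, Pi.star_apply, RCLike.star_def, map_div₀, Complex.conj_ofReal,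
      Complex.ofReal_pow]
    rw [← Complex.conj_mul', div_mul_eq_mul_div]
  ext l
  rw [localL, outer, Matrix.vecMulVec_mulVec, hdot]
  simp only [collapsed, ← hN, Pi.smul_apply, MulOpposite.smul_eq_mul_unop, MulOpposite.unop_op]
  -- When `N = 0` the amplitudes on this block all vanish, so both sides are zero.
  by_cases h0 : N = 0
  · have : Ψ (glue k z l) = 0 := by
      have h := (Finset.sum_eq_zero_iff_of_nonneg fun _ _ => by positivity).mp (hN.symm.trans h0) l
        (Finset.mem_univ l)
      simpa using h
    simp [this]
  · have hs : ((Real.sqrt N : ℝ) : ℂ) ≠ 0 := by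
      rw [Complex.ofReal_ne_zero, Real.sqrt_ne_zero hN0]
      exact h0
    field_simp
    rw [sq, hNN]

/-- For each `k` the summand is block diagonal in `z` and fixes every block of `Ψ`; `L` averages
these operators over the `n.choose m` sets. -/
lemma overlapOperator_mulVec (m : ℕ) (hm : m ≤ n) (Ψ : Bits (Fin n) → ℂ) :
    overlapOperator m Ψ *ᵥ Ψ = Ψ := by
  have hk : ∀ k : Finset (Fin n), (∑ z : Bits {i // i ∉ k},
      (localL Ψ k z ⊗ₖ outer (ket z)).submatrix (splitBits k) (splitBits k)) *ᵥ Ψ = Ψ := by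
    intro k
    ext x
    have h := congrFun (localL_mulVec Ψ k (splitBits k x).2) (splitBits k x).1
    simp only [glue_splitBits] at h
    rw [← h]
    simp only [Matrix.mulVec, dotProduct, sum_local_apply]
    rw [← (splitBits k).symm.sum_comp, Fintype.sum_prod_type]
    refine Finset.sum_congr rfl fun l _ => ?_
    rw [Finset.sum_eq_single (splitBits k x).2]
    · simp [glue]
    · intro z _ hz
      simp [hz]
    · simp
  have hc : (n.choose m : ℂ) ≠ 0 := by exact_mod_cast (Nat.choose_pos hm).ne'
  rw [overlapOperator, Matrix.smul_mulVec, Matrix.sum_mulVec]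
  simp only [hk, Finset.sum_const, Finset.card_powersetCard, Finset.card_univ, Fintype.card_fin]
  rw [← Nat.cast_smul_eq_nsmul ℂ, smul_smul, inv_mul_cancel₀ hc, one_smul]

/-- Makes the value of the diagonal conjugation at the zeros of `Ψ` irrelevant. -/
lemma overlapOperator_apply_eq_zero (m : ℕ) (Ψ : Bits (Fin n) → ℂ) (x y : Bits (Fin n))
    (h : Ψ x = 0 ∨ Ψ y = 0) : overlapOperator m Ψ x y = 0 := by
  rw [overlapOperator, Matrix.smul_apply, Matrix.sum_apply, Finset.sum_eq_zero, smul_zero]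
  intro k _
  rw [sum_local_apply]
  split_ifs with hz
  · rcases h with h | h
    · simp [localL, outer, Matrix.vecMulVec_apply, collapsed, glue_splitBits, h]
    · rw [← hz]
      simp [localL, outer, Matrix.vecMulVec_apply, collapsed, glue_splitBits, h]
  · rfl

/-- The transition matrix is similar to the overlap operator. -/
lemma charpoly_transitionMatrix (m : ℕ) (Ψ : Bits (Fin n) → ℂ) :
    (transitionMatrix m Ψ).charpoly = (overlapOperator m Ψ).charpoly := by
  -- `F S^(1/2)` is `diag Ψ`, which may be singular. Replacing zeros by `1` makes it invertible
  -- without changing the conjugate, as `L` vanishes on those rows and columns.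
  let g : Bits (Fin n) → ℂ := fun x => if Ψ x = 0 then 1 else Ψ x
  have hg : ∀ x, g x ≠ 0 := by
    intro x
    by_cases h : Ψ x = 0 <;> simp [g, h]
  have hpolar : ∀ x, Complex.exp (Complex.I * (Complex.arg (Ψ x) : ℂ)) * (‖Ψ x‖ : ℂ) = Ψ x := by
    intro x
    rw [mul_comm, mul_comm Complex.I]
    exact Complex.norm_mul_exp_arg_mul_I _
  have hpolar' : ∀ x, (‖Ψ x‖ : ℂ)⁻¹ * star (Complex.exp (Complex.I * (Complex.arg (Ψ x) : ℂ)))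
      = (Ψ x)⁻¹ := by
    intro x
    conv_rhs => rw [← hpolar x, mul_inv, ← Complex.exp_neg, mul_comm]
    congr 1
    rw [RCLike.star_def, ← Complex.exp_conj]
    simp
  have hP : transitionMatrix m Ψ
      = Matrix.diagonal (fun x => (g x)⁻¹) * (overlapOperator m Ψ * Matrix.diagonal g) := by
    ext x y
    simp only [transitionMatrix, Matrix.diagonal_conjTranspose, Matrix.diagonal_mul_diagonal]
    rw [mul_assoc, Matrix.diagonal_mul_diagonal, Matrix.mul_diagonal, Matrix.diagonal_mul,
      Matrix.diagonal_mul, Matrix.mul_diagonal, Pi.star_apply, hpolar', hpolar]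
    by_cases h : Ψ x = 0 ∨ Ψ y = 0
    · simp [overlapOperator_apply_eq_zero m Ψ x y h]
    · push Not at h
      simp [g, h.1, h.2, mul_assoc]
  rw [hP, Matrix.charpoly_mul_comm, mul_assoc, Matrix.diagonal_mul_diagonal]
  simp [hg]

lemma trace_outer_mul_re (Ψ : Bits (Fin n) → ℂ) (ρ : DensityOp (Fin n)) :
    (Matrix.vecMulVec Ψ (star Ψ) * ρ.mat).trace.re = fidelity Ψ ρ := by
  rw [Matrix.trace_mul_comm, trace_mul_vecMulVec, fidelity]

/-- The fidelity is a lower bound for the expected overlap. -/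
lemma fidelity_le_trace (m : ℕ) (hm : m ≤ n) (Ψ : Bits (Fin n) → ℂ)
    (hΨ : star Ψ ⬝ᵥ Ψ = 1) (ρ : DensityOp (Fin n)) :
    fidelity Ψ ρ ≤ (overlapOperator m Ψ * ρ.mat).trace.re := by
  have hpos := trace_mul_re_nonneg (posSemidef_sub_vecMulVec (overlapOperator_posSemidef m Ψ)
    (overlapOperator_mulVec m hm Ψ) hΨ) ρ.posSemidef
  rw [sub_mul, Matrix.trace_sub, Complex.sub_re, trace_outer_mul_re] at hpos
  linarith

/-- The upper bound for the expected overlap in terms of the spectral gap. -/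
lemma trace_le_of_gap (m : ℕ) (hm : m ≤ n) (Ψ : Bits (Fin n) → ℂ) (hΨ : star Ψ ⬝ᵥ Ψ = 1)
    (ρ : DensityOp (Fin n)) {μ : ℝ} (hμ : secondLargestEigenvalue (transitionMatrix m Ψ) = μ)
    (hμ1 : μ < 1) :
    (overlapOperator m Ψ * ρ.mat).trace.re ≤ μ * (1 - fidelity Ψ ρ) + fidelity Ψ ρ := by
  rw [secondLargestEigenvalue, charpoly_transitionMatrix] at hμ
  have hpos := trace_mul_re_nonneg
    (posSemidef_sub_of_gap (overlapOperator_posSemidef m Ψ).isHermitian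
      (overlapOperator_mulVec m hm Ψ) hΨ hμ hμ1) ρ.posSemidef
  rw [sub_mul, add_mul, Matrix.smul_mul, sub_mul, one_mul, Matrix.trace_sub, Matrix.trace_add,
    Matrix.trace_smul, Matrix.trace_sub, ρ.trace_eq_one, Complex.sub_re, Complex.add_re,
    smul_eq_mul, Complex.re_ofReal_mul, Complex.sub_re, Complex.one_re,
    trace_outer_mul_re] at hpos
  linarith

end OverlapOperator

end ShadowOverlap

end

theorem mainTheorem8 (n m : ℕ) (hm1 : 1 ≤ m) (hm : m ≤ n)
    (Ψ : ShadowOverlap.Bits (Fin n) → ℂ) (hΨ : ∑ x, ‖Ψ x‖ ^ 2 = 1)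
    (ρ : ShadowOverlap.DensityOp (Fin n)) :
    (∀ τ : ℝ, 0 < τ →
      ShadowOverlap.secondLargestEigenvalue (ShadowOverlap.transitionMatrix m Ψ) = 1 - 1 / τ →
      ∀ ε : ℝ, ShadowOverlap.shadowOverlap m hm Ψ ρ ≥ 1 - ε →
        ShadowOverlap.fidelity Ψ ρ ≥ 1 - τ * ε) ∧
    (∀ ε : ℝ, ShadowOverlap.fidelity Ψ ρ ≥ 1 - ε →
      ShadowOverlap.shadowOverlap m hm Ψ ρ ≥ 1 - ε) := by
  have hnorm : dotProduct (star Ψ) Ψ = 1 := by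
    simp only [dotProduct, Pi.star_apply, RCLike.star_def, Complex.conj_mul']
    exact_mod_cast hΨ
  rw [ShadowOverlap.shadowOverlap_eq_trace m hm1 hm Ψ ρ]
  refine ⟨fun τ hτ hgap ε hε => ?_, fun ε hε =>
    hε.le.trans (ShadowOverlap.fidelity_le_trace m hm Ψ hnorm ρ)⟩
  have hle := ShadowOverlap.trace_le_of_gap m hm Ψ hnorm ρ hgap
    (by linarith [one_div_pos.mpr hτ])
  -- With `λ₁ = 1 - 1 / τ` the upper bound on the overlap is `1 - (1 - fidelity) / τ`.
  have h : (1 - ShadowOverlap.fidelity Ψ ρ) / τ ≤ ε := by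
    rw [div_eq_mul_one_div]
    linarith
  rw [div_le_iff₀ hτ] at h
  linarith
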